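/- Let $\mathbb V$ be a congruence modular variety of (finitary) universal algebras, i.e. a variety such that the lattice of congruences of every algebra of $\mathbb V$ is modular, and let $Y$ be an algebra of $\mathbb V$. Let $Pt_Y\mathbb V$ be the category whose objects are the homomorphisms $X\to Y$ equipped with a chosen section, and whose morphisms are the homomorphisms over $Y$ commuting with the chosen sections; it is finitely complete and pointed. Then $Pt_Y\mathbb V$ satisfies Axiom $\ast$. Explicitly, for a map $f$ let $R[f]$ be its kernel equivalence relation. For equivalence relations $R,S$ on an object $W$, let $R\,\square\, S$ be the inverse image of $S\times S$ along $R\rightarrowtail W\times W$ (the object of quadruples $(x,y,t,z)$ with $xRy$, $tRz$, $xSt$, $ySz$), let $R\times_1 S$ be the pullback of $d_1:R\to W$ and $d_0:S\to W$, and let $\zeta_{R,S}:R\,\square\, S\to R\times_1 S$ be the map $(x,y,t,z)\mapsto (xRySz)$. Let $(\pi_0,\pi_1):W\rightarrowtail X\times Z$ be any relation in $Pt_Y\mathbb V$ which is - right punctual: there is $t:Z\to W$ with $\pi_1 t=1_Z$ and $\pi_0 t=0$; - difunctional: $R[\pi_0]\cap R[\pi_1]$ is the diagonal of $W$ and $\zeta_{R[\pi_0],R[\pi_1]}$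 is an isomorphism; and let $T$ be any equivalence relation on $W$ in $Pt_Y\mathbb V$. Then $\zeta_{R[\pi_0],T}:R[\pi_0]\,\square\, T\to R[\pi_0]\times_1 T$ is an extremal epimorphism in $Pt_Y\mathbb V$ (this is Axiom $\ast$), and the equivalence relations $R[\pi_0]$ and $T$ permute: $R[\pi_0]\circ T=T\circ R[\pi_0]$ as relations on the underlying set of $W$. -/

import Mathlib

open CategoryTheory CategoryTheory.Limits

universe u v w

noncomputable section

/-! ### Varieties of universal algebra and their congruences -/

/-- A congruence on an algebra `A`: an equivalence relation compatible with all operations. -/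
structure AlgCongruence (L : FirstOrder.Language.{u, v}) (A : Type w) [L.Structure A] extends Setoid A where
  map_fun : ∀ {n : ℕ} (f : L.Functions n) (x y : Fin n → A),
    (∀ i, r (x i) (y i)) → r (FirstOrder.Language.Structure.funMap f x) (FirstOrder.Language.Structure.funMap f y)

namespace AlgCongruence

variable {L : FirstOrder.Language.{u, v}} {A : Type w} [L.Structure A]

theorem toSetoid_injective :
    Function.Injective (AlgCongruence.toSetoid : AlgCongruence L A → Setoid A) := by
  rintro ⟨s, hs⟩ ⟨t, ht⟩ h
  cases h
  rfl

/-- Congruences are ordered by inclusion. -/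
instance : PartialOrder (AlgCongruence L A) :=
  PartialOrder.lift AlgCongruence.toSetoid toSetoid_injective

instance : InfSet (AlgCongruence L A) where
  sInf S :=
    { toSetoid := sInf (AlgCongruence.toSetoid '' S)
      map_fun := by
        rintro n f x y h _ ⟨c, hc, rfl⟩
        exact c.map_fun f x y fun i => h i _ ⟨c, hc, rfl⟩ }

/-- The complete lattice of congruences of `A`; infima are intersections. -/
instance : CompleteLattice (AlgCongruence L A) :=
  completeLatticeOfInf (AlgCongruence L A) fun S => by
    refine ⟨fun c hc => ?_, fun c hc => ?_⟩
    · exact sInf_le (a := c.toSetoid) ⟨c, hc, rfl⟩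
    · refine le_sInf (a := c.toSetoid) ?_
      rintro _ ⟨d, hd, rfl⟩
      exact hc hd

end AlgCongruence

/-- A variety of algebras with (finitary) operations `L`, given by a set of identities `s ≈ t`
between terms. -/
structure AlgVariety (L : FirstOrder.Language.{u, v}) where
  /-- the identities, as pairs of terms in countably many variables -/
  identities : Set (L.Term ℕ × L.Term ℕ)

/-- The algebras of a variety. The empty algebra is allowed (when `L` has no constants). -/
structure AlgVariety.Algebra {L : FirstOrder.Language.{u, v}} (V : AlgVariety L) where
  /-- the underlying set -/
  carrier : Type w
  [str : L.Structure carrier]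
  satisfies : ∀ e ∈ V.identities, ∀ x : ℕ → carrier, e.1.realize x = e.2.realize x

namespace AlgVariety

variable {L : FirstOrder.Language.{u, v}} (V : AlgVariety L)

instance : CoeSort (Algebra.{u, v, w} V) (Type w) := ⟨Algebra.carrier⟩

instance (A : Algebra.{u, v, w} V) : L.Structure A := A.str

/-- The category of algebras of the variety and their homomorphisms. -/
instance : Category (Algebra.{u, v, w} V) where
  Hom A B := L.Hom A B
  id A := FirstOrder.Language.Hom.id L A
  comp f g := g.comp f

instance : ConcreteCategory (Algebra.{u, v, w} V) (fun A B => L.Hom A B) where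
  hom f := f
  ofHom f := f

/-- A variety is congruence modular when the congruence lattices of all its algebras satisfy
the modular law. -/
def IsCongruenceModular : Prop :=
  ∀ A : Algebra.{u, v, w} V, IsModularLattice (AlgCongruence L A)

variable {V}

section Limits

variable [L.IsAlgebraic] {J : Type} [SmallCategory J] (F : J ⥤ Algebra.{u, v, w} V)

/-- The algebra of compatible families of a diagram of algebras. -/
def limitAlgebra : Algebra.{u, v, w} V where
  carrier := {x : ∀ j, F.obj j // ∀ {i j : J} (a : i ⟶ j), F.map a (x i) = x j}
  str :=
    { funMap := fun f x => ⟨fun j => FirstOrder.Language.Structure.funMap f fun i => (x i).1 j, by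
        intro i j a
        have h := FirstOrder.Language.HomClass.map_fun (L := L) (F := L.Hom (F.obj i) (F.obj j)) (F.map a) f
          (fun k => (x k).1 i)
        refine h.trans ?_
        congr 1
        funext k
        exact (x k).2 a⟩
      RelMap := fun r _ => isEmptyElim r }
  satisfies e he x := by
    let _ : L.Structure {x : ∀ j, F.obj j // ∀ {i j : J} (a : i ⟶ j), F.map a (x i) = x j} :=
    { funMap := fun f x => ⟨fun j => FirstOrder.Language.Structure.funMap f fun i => (x i).1 j, by
        intro i j a
        have h := FirstOrder.Language.HomClass.map_fun (L := L) (F := L.Hom (F.obj i) (F.obj j)) (F.map a) f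
          (fun k => (x k).1 i)
        refine h.trans ?_
        congr 1
        funext k
        exact (x k).2 a⟩
      RelMap := fun r _ => isEmptyElim r }
    have key : ∀ (t : L.Term ℕ) (j : J), (t.realize x).1 j = t.realize fun n => (x n).1 j := by
      intro t j
      induction t with
      | var n => rfl
      | func f ts ih =>
        change FirstOrder.Language.Structure.funMap f (fun i => ((ts i).realize x).1 j) = _
        simp only [ih, FirstOrder.Language.Term.realize_func]
    apply Subtype.ext
    funext j
    exact (key _ j).trans (((F.obj j).satisfies e he _).trans (key _ j).symm)

/-- The limit cone on `limitAlgebra`. -/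
def limitCone : Cone F where
  pt := limitAlgebra F
  π :=
    { app := fun j =>
        ({ toFun := fun x => x.1 j
           map_fun' := fun _ _ => rfl
           map_rel' := fun r => isEmptyElim r } : L.Hom (limitAlgebra F) (F.obj j))
      naturality := fun i j a => by
        apply FirstOrder.Language.Hom.ext
        intro x
        exact (x.2 a).symm }

/-- `limitCone` is a limit. -/
def limitConeIsLimit : IsLimit (limitCone F) where
  lift s :=
    ({ toFun := fun x => ⟨fun j => s.π.app j x, fun {i j} a =>
          congrArg (fun h : s.pt ⟶ F.obj j => h x) (s.w a)⟩
       map_fun' := fun f x => by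
        apply Subtype.ext
        funext j
        exact FirstOrder.Language.HomClass.map_fun (L := L) (F := L.Hom (s.pt) (F.obj j)) (s.π.app j) f x
       map_rel' := fun r => isEmptyElim r } : L.Hom s.pt (limitAlgebra F))
  fac s j := rfl
  uniq s m h := by
    apply FirstOrder.Language.Hom.ext
    intro x
    apply Subtype.ext
    funext j
    exact congrArg (fun g : s.pt ⟶ F.obj j => g x) (h j)

end Limits

/-- The category of algebras of a variety is finitely complete. -/
instance [L.IsAlgebraic] : HasFiniteLimits (Algebra.{u, v, w} V) where
  out _ _ _ := ⟨fun F => ⟨⟨⟨limitCone F, limitConeIsLimit F⟩⟩⟩⟩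

end AlgVariety

/-! ### The fibres of the fibration of points -/

section Fibre

variable {C : Type u} [Category.{v} C]

/-- The fibre `Pt_Y C` of the fibration of points above `Y`: the coslice under `1_Y` of the
slice `C / Y`. Its objects are the split epimorphisms `X ⟶ Y` with a chosen section, its
morphisms are the morphisms over `Y` which commute with the sections. -/
abbrev PtFibre (Y : C) := Under (Over.mk (𝟙 Y))

variable (Y : C)

instance [HasFiniteLimits C] : HasFiniteLimits (PtFibre Y) where
  out J _ _ :=
    inferInstanceAs (HasLimitsOfShape J (StructuredArrow (Over.mk (𝟙 Y)) (𝟭 (Over Y))))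

/-- The identity of `Y` is both initial and terminal in `Pt_Y C`. -/
theorem PtFibre.isZero_id : IsZero (Under.mk (𝟙 (Over.mk (𝟙 Y))) : PtFibre Y) := by
  refine ⟨fun X => ⟨⟨⟨Under.homMk X.hom (by simp)⟩, fun f => ?_⟩⟩, fun X => ⟨⟨⟨Under.homMk
    (Over.mkIdTerminal.from X.right) (Over.mkIdTerminal.hom_ext _ _)⟩, fun f => ?_⟩⟩⟩
  · apply Under.UnderMorphism.ext
    have := Under.w f
    simpa using this
  · apply Under.UnderMorphism.ext
    exact Over.mkIdTerminal.hom_ext _ _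

instance : HasZeroObject (PtFibre Y) := ⟨⟨_, PtFibre.isZero_id Y⟩⟩

instance : HasZeroMorphisms (PtFibre Y) := HasZeroObject.zeroMorphismsOfZeroObject

end Fibre

/-! ### Internal equivalence relations -/

section Relations

variable {C : Type u} [Category.{v} C] [HasFiniteLimits C]

/-- An internal equivalence relation `(d₀, d₁) : E ↣ X × X` on `X`. -/
structure InternalEquiv (X : C) where
  obj : C
  d₀ : obj ⟶ X
  d₁ : obj ⟶ X
  mono : Mono (prod.lift d₀ d₁)
  refl : ∃ s : X ⟶ obj, s ≫ d₀ = 𝟙 X ∧ s ≫ d₁ = 𝟙 X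
  symm : ∃ σ : obj ⟶ obj, σ ≫ d₀ = d₁ ∧ σ ≫ d₁ = d₀
  trans : ∃ τ : pullback d₁ d₀ ⟶ obj,
    τ ≫ d₀ = pullback.fst d₁ d₀ ≫ d₀ ∧ τ ≫ d₁ = pullback.snd d₁ d₀ ≫ d₁

attribute [instance] InternalEquiv.mono

namespace InternalEquiv

/-- The kernel equivalence relation `R[f]` of `f : X ⟶ Y`. -/
def ker {X Y : C} (f : X ⟶ Y) : InternalEquiv X where
  obj := pullback f f
  d₀ := pullback.fst f f
  d₁ := pullback.snd f f
  mono := ⟨fun a b h => pullback.hom_ext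
    (by simpa only [Category.assoc, prod.lift_fst] using congrArg (· ≫ prod.fst) h)
    (by simpa only [Category.assoc, prod.lift_snd] using congrArg (· ≫ prod.snd) h)⟩
  refl := ⟨pullback.lift (𝟙 X) (𝟙 X) rfl, pullback.lift_fst _ _ _, pullback.lift_snd _ _ _⟩
  symm := ⟨pullback.lift (pullback.snd f f) (pullback.fst f f) pullback.condition.symm,
    pullback.lift_fst _ _ _, pullback.lift_snd _ _ _⟩
  trans := ⟨pullback.lift (pullback.fst _ _ ≫ pullback.fst f f)
    (pullback.snd _ _ ≫ pullback.snd f f) (by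
      rw [Category.assoc, Category.assoc, pullback.condition, ← pullback.condition (f := f) (g := f),
        ← pullback.condition_assoc, pullback.condition (f := f) (g := f)]),
    pullback.lift_fst _ _ _, pullback.lift_snd _ _ _⟩

variable {X : C} (R S : InternalEquiv X)

/-- `R □ S`: the inverse image of the relation `S × S` on `X × X` along `(d₀, d₁) : R ↣ X × X`.
In set-theoretical terms it consists of the quadruples `(x, y, t, z)` with
`x R y`, `t R z`, `x S t` and `y S z`. -/
abbrev square : C :=
  pullback (prod.map (prod.lift R.d₀ R.d₁) (prod.lift R.d₀ R.d₁))
    (prod.lift (prod.map S.d₀ S.d₀) (prod.map S.d₁ S.d₁))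

/-- The first edge `x R y` of an element `(x, y, t, z)` of `R □ S`. -/
def squareFst : square R S ⟶ R.obj := pullback.fst _ _ ≫ prod.fst

/-- The second edge `y S z` of an element `(x, y, t, z)` of `R □ S`. -/
def squareSnd : square R S ⟶ S.obj := pullback.snd _ _ ≫ prod.snd

theorem square_condition : squareFst R S ≫ R.d₁ = squareSnd R S ≫ S.d₀ := by
  have h := pullback.condition
    (f := prod.map (prod.lift R.d₀ R.d₁) (prod.lift R.d₀ R.d₁))
    (g := prod.lift (prod.map S.d₀ S.d₀) (prod.map S.d₁ S.d₁))
  have h' := congrArg (fun k => k ≫ prod.fst ≫ prod.snd) h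
  simpa only [squareFst, squareSnd, Category.assoc, prod.map_fst_assoc, prod.lift_snd,
    prod.lift_fst_assoc, prod.map_snd] using h'

/-- The canonical factorization `ζ : R □ S ⟶ R ×₁ S`, `(x, y, t, z) ↦ x R y S z`, where
`R ×₁ S` is the pullback of `d₁ : R ⟶ X` and `d₀ : S ⟶ X`. -/
def zeta : square R S ⟶ pullback R.d₁ S.d₀ :=
  pullback.lift (squareFst R S) (squareSnd R S) (square_condition R S)

/-- `R` and `S` have a sharp intersection: `R ∩ S` is the diagonal of `X` and `ζ` is an
isomorphism. -/
structure IsSharp : Prop where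
  inter : Subobject.mk (prod.lift R.d₀ R.d₁) ⊓
    Subobject.mk (prod.lift S.d₀ S.d₁) = Subobject.mk (diag X)
  isIso : IsIso (zeta R S)

end InternalEquiv

/-- The span `(f, g) : W ⟶ X × Z` is a relation. -/
def IsRelationSpan {W X Z : C} (f : W ⟶ X) (g : W ⟶ Z) : Prop := Mono (prod.lift f g)

/-- The span `(f, g)` is right punctual: `g` has a section `t` with `f t = 0`. -/
def IsRightPunctual [HasZeroMorphisms C] {W X Z : C} (f : W ⟶ X) (g : W ⟶ Z) : Prop :=
  ∃ t : Z ⟶ W, t ≫ g = 𝟙 Z ∧ t ≫ f = 0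

/-- The relation `(f, g)` is difunctional: `R[f]` and `R[g]` have a sharp intersection. -/
def IsDifunctional {W X Z : C} (f : W ⟶ X) (g : W ⟶ Z) : Prop :=
  InternalEquiv.IsSharp (InternalEquiv.ker f) (InternalEquiv.ker g)

variable (C) in
/-- Axiom ∗ for a pointed category: for every right punctual difunctional relation
`(f, g) : W ↣ X × Z` and every equivalence relation `T` on `W`, the canonical factorization
`R[f] □ T ⟶ R[f] ×₁ T` is an extremal epimorphism. -/
def AxiomStar [HasZeroObject C] [HasZeroMorphisms C] : Prop :=
  ∀ ⦃W X Z : C⦄ (f : W ⟶ X) (g : W ⟶ Z), IsRelationSpan f g → IsRightPunctual f g →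
    IsDifunctional f g → ∀ T : InternalEquiv W,
      ExtremalEpi (InternalEquiv.zeta (InternalEquiv.ker f) T)

end Relations

/-- The relation on the underlying set of `W` given by an internal equivalence relation `T` on
an object `W` of `Pt_Y V`. -/
def AlgVariety.ptRel {L : FirstOrder.Language.{u, v}} [L.IsAlgebraic] {V : AlgVariety L}
    {Y : AlgVariety.Algebra.{u, v, w} V} {W : PtFibre Y} (T : InternalEquiv W) :
    W.right.left → W.right.left → Prop :=
  fun a b => ∃ t : T.obj.right.left, T.d₀.right.left t = a ∧ T.d₁.right.left t = b

end

/-! On the algebra `W` let a = R[π₀], b = R[π₁] and let e be the kernel of `W → Y`. Since `W` is a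
relation, a ∩ b is trivial. Morphisms of points lie over `Y`, so every internal equivalence relation
is contained in e.

Punctuality and difunctionality give e ⊆ a ∘ b. If p, p' lie over the same element of `Y`, then
t(π₁p') and t(π₁p) have the same image under π₀, namely the base point of that fibre, while t(π₁p)
and p have the same image under π₁. The fourth vertex of this square is a-related to p and b-related
to p' (`exists_of_isRightPunctual`).

It remains to show that such an a permutes with every congruence c ⊆ e
(`exists_of_isCongruenceModular`). Given y c z, one moves from the a-class of y to that of z along
the values m(y,y,z,z) of a chain of Day operations, so that every element of one class is c-related
to an element of the next (`Reaches`). The moves come from a term condition (`reaches_of_eq`),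
proved by the shifting lemma and the decomposition of e.

Finally, `zeta` is surjective exactly when paths x R y S z can be rerouted as x S c R z, and
surjections are extremal epimorphisms. -/

noncomputable section

open FirstOrder FirstOrder.Language.Structure

/-! ### Congruences: the shifting lemma and joins as chains -/

namespace AlgCongruence

variable {L : FirstOrder.Language.{u, v}} {A : Type w} [L.Structure A]

theorem inf_of_r {c d : AlgCongruence L A} {x y : A} (hc : c.r x y) (hd : d.r x y) :
    (c ⊓ d).r x y := by
  let e : AlgCongruence L A :=
    { toSetoid := c.toSetoid ⊓ d.toSetoid
      map_fun := fun f x y h =>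
        ⟨c.map_fun f x y fun i => (h i).1, d.map_fun f x y fun i => (h i).2⟩ }
  have he : e ≤ c ⊓ d := le_inf (fun _ _ h => h.1) (fun _ _ h => h.2)
  exact he ⟨hc, hd⟩

/-- The shifting lemma: in a square with sides in `a` and `b`, a congruence `c` containing
`a ⊓ b` can be shifted along `a` from one `b`-side to the other. -/
theorem shifting [IsModularLattice (AlgCongruence L A)] {a b c : AlgCongruence L A}
    (hc : a ⊓ b ≤ c) {x y x' y' : A} (hx : a.r x x') (hy : a.r y y') (hb : b.r x y)
    (hb' : b.r x' y') (h : c.r x y) : c.r x' y' := by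
  have hl : a ≤ (b ⊓ c) ⊔ a := le_sup_right
  have hr : b ⊓ c ≤ (b ⊓ c) ⊔ a := le_sup_left
  have h1 : ((b ⊓ c) ⊔ a).r x' y' :=
    Setoid.trans' _ (hl (Setoid.symm' _ hx)) (Setoid.trans' _ (hr (inf_of_r hb h)) (hl hy))
  -- The modular law applies because b ⊓ c ≤ b.
  have h2 : ((b ⊓ c) ⊔ a) ⊓ b ≤ (b ⊓ c) ⊔ a ⊓ b :=
    IsModularLattice.sup_inf_le_assoc_of_le a inf_le_left
  have h3 : (b ⊓ c) ⊔ a ⊓ b ≤ c := sup_le inf_le_right hc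
  exact h3 (h2 (inf_of_r h1 hb'))

/-- The transitive closure of the union of two congruences, as a congruence. -/
def chain (c d : AlgCongruence L A) : AlgCongruence L A where
  r := Relation.ReflTransGen fun x y => c.r x y ∨ d.r x y
  iseqv :=
    { refl := fun _ => .refl
      symm := fun h => by
        induction h with
        | refl => exact .refl
        | tail _ h ih => exact .head (h.imp (Setoid.symm' _) (Setoid.symm' _)) ih
      trans := .trans }
  map_fun := by
    classical
    intro n f x y h
    -- The arguments are changed one coordinate at a time; those in `s` have already been changed.
    have key : ∀ s : Finset (Fin n), Relation.ReflTransGen (fun x y => c.r x y ∨ d.r x y)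
        (funMap f x) (funMap f (s.piecewise y x)) := by
      intro s
      induction s using Finset.induction_on with
      | empty => simpa using .refl
      | insert i s hi ih =>
        refine ih.trans ?_
        rw [Finset.piecewise_insert]
        have h0 : s.piecewise y x = Function.update (s.piecewise y x) i (x i) := by
          rw [eq_comm, Function.update_eq_self_iff, Finset.piecewise_eq_of_notMem _ _ _ hi]
        have hr : ∀ (e : AlgCongruence L A) (z z' : A), e.r z z' →
            e.r (funMap f (Function.update (s.piecewise y x) i z))
              (funMap f (Function.update (s.piecewise y x) i z')) := by
          intro e z z' hz
          refine e.map_fun f _ _ fun j => ?_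
          rcases eq_or_ne j i with rfl | hj
          · simpa using hz
          · simp [hj]
        rw [h0, Function.update_idem]
        exact Relation.ReflTransGen.lift (r := fun x y => c.r x y ∨ d.r x y)
          (fun z => funMap f (Function.update (s.piecewise y x) i z))
          (fun z z' hz => hz.imp (hr c z z') (hr d z z')) _ _ (h i)
    simpa using key Finset.univ

theorem sup_le_chain (c d : AlgCongruence L A) : c ⊔ d ≤ chain c d :=
  sup_le (fun _ _ h => .single (.inl h)) (fun _ _ h => .single (.inr h))

variable (L A) in
/-- An operation of arity `ι` preserving all congruences of `A`. -/
def Preserving {ι : Type*} (φ : (ι → A) → A) : Prop :=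
  ∀ (c : AlgCongruence L A) (x y : ι → A), (∀ i, c.r (x i) (y i)) → c.r (φ x) (φ y)

variable (L A) in
/-- Two consecutive operations in a chain satisfying the identities of Day's terms. -/
def DayStep (φ ψ : (Fin 4 → A) → A) : Prop :=
  Preserving L A φ ∧ Preserving L A ψ ∧
  (∀ x y, φ ![x, y, y, x] = x) ∧ (∀ x y, ψ ![x, y, y, x] = x) ∧
  ((∀ x y, φ ![x, x, y, y] = ψ ![x, x, y, y]) ∨
    ∀ x y z, φ ![x, y, y, z] = ψ ![x, y, y, z])

end AlgCongruence

/-! ### Day's operations from modularity -/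

namespace AlgVariety

variable {L : FirstOrder.Language.{u, v}} [L.IsAlgebraic] {V : AlgVariety L}

/-- The algebra of congruence preserving operations of finite arity on `A`. -/
def preservingAlgebra (A : Algebra.{u, v, w} V) (k : ℕ) : Algebra.{u, v, w} V where
  carrier := {φ : (Fin k → A) → A // AlgCongruence.Preserving L A φ}
  str :=
    { funMap := fun f φ => ⟨fun x => funMap f fun i => (φ i).1 x,
        fun c x y h => c.map_fun f _ _ fun i => (φ i).2 c x y h⟩
      RelMap := fun r _ => isEmptyElim r }
  satisfies e he x := by
    let _ : L.Structure {φ : (Fin k → A) → A // AlgCongruence.Preserving L A φ} :=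
      { funMap := fun f φ => ⟨fun x => funMap f fun i => (φ i).1 x,
          fun c x y h => c.map_fun f _ _ fun i => (φ i).2 c x y h⟩
        RelMap := fun r _ => isEmptyElim r }
    have key : ∀ (t : L.Term ℕ) (a : Fin k → A),
        (t.realize x).1 a = t.realize fun n => (x n).1 a := by
      intro t a
      induction t with
      | var n => rfl
      | func f ts ih =>
        change funMap f (fun i => ((ts i).realize x).1 a) = _
        simp only [ih, FirstOrder.Language.Term.realize_func]
    apply Subtype.ext
    funext a
    exact (key _ a).trans ((A.satisfies e he _).trans (key _ a).symm)

/-- The congruence on the algebra of operations identifying those which agree on a given set. -/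
def agreeOn (A : Algebra.{u, v, w} V) (k : ℕ) (S : Set (Fin k → A)) :
    AlgCongruence L (preservingAlgebra A k) where
  r φ ψ := ∀ x ∈ S, φ.1 x = ψ.1 x
  iseqv := ⟨fun _ _ _ => rfl, fun h x hx => (h x hx).symm,
    fun h h' x hx => (h x hx).trans (h' x hx)⟩
  map_fun f _ _ h x hx := congrArg (funMap f) (funext fun i => h i x hx)

/-- Congruence preserving operations on an algebra of a congruence modular variety which satisfy
the identities of Day's terms. -/
theorem exists_day_chain (hV : IsCongruenceModular.{u, v, w} V) (A : Algebra.{u, v, w} V) :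
    Relation.ReflTransGen (AlgCongruence.DayStep L A) (fun x => x 0) (fun x => x 3) := by
  -- This algebra replaces the free algebra on four generators: its projections serve as generators,
  -- and the only property of terms needed later is that they preserve congruences.
  have _ := hV (preservingAlgebra A 4)
  let a := agreeOn A 4 {x | x 0 = x 1 ∧ x 2 = x 3}
  let b := agreeOn A 4 {x | x 0 = x 3 ∧ x 1 = x 2}
  let c := agreeOn A 4 {x | x 1 = x 2}
  let p (i : Fin 4) : preservingAlgebra A 4 := ⟨fun x => x i, fun _ _ _ h => h i⟩
  -- Agreement on a larger set is a smaller congruence.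
  have hcb : c ≤ b := fun _ _ h x hx => h x hx.2
  -- The zigzag is p₀ a p₁ c p₂ a p₃. Since also p₀ b p₃, modularity joins p₀ to p₃ by steps in c
  -- and a ⊓ b, all of which stay in the b-class of p₀.
  have h1 : (c ⊔ a).r (p 0) (p 3) :=
    Setoid.trans' _ ((le_sup_right : a ≤ c ⊔ a) (show a.r (p 0) (p 1) from fun x hx => hx.1))
      (Setoid.trans' _ ((le_sup_left : c ≤ c ⊔ a) (show c.r (p 1) (p 2) from fun x hx => hx))
        ((le_sup_right : a ≤ c ⊔ a) (show a.r (p 2) (p 3) from fun x hx => hx.2)))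
  have h2 : b.r (p 0) (p 3) := fun x hx => hx.1
  have h3 := AlgCongruence.sup_le_chain c (a ⊓ b)
    (IsModularLattice.sup_inf_le_assoc_of_le a hcb (AlgCongruence.inf_of_r h1 h2))
  have h4 : ∀ q, (AlgCongruence.chain c (a ⊓ b)).r (p 0) q → b.r (p 0) q ∧
      Relation.ReflTransGen (AlgCongruence.DayStep L A) (p 0).1 q.1 := by
    intro q hq
    induction hq with
    | refl => exact ⟨Setoid.refl' _ _, .refl⟩
    | @tail q q' _ hs ih =>
      have hb : b.r q q' := hs.elim (fun h => hcb h) (fun h => (inf_le_right : a ⊓ b ≤ b) h)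
      have hb' : b.r (p 0) q' := Setoid.trans' _ ih.1 hb
      refine ⟨hb', ih.2.tail ⟨q.2, q'.2, fun x y => ?_, fun x y => ?_, ?_⟩⟩
      · exact (ih.1 ![x, y, y, x] ⟨rfl, rfl⟩).symm
      · exact (hb' ![x, y, y, x] ⟨rfl, rfl⟩).symm
      · rcases hs with h | h
        · exact .inr fun x y z => h ![x, y, y, z] rfl
        · exact .inl fun x y => (inf_le_left : a ⊓ b ≤ a) h ![x, x, y, y] ⟨rfl, rfl⟩
  exact (h4 _ h3).2

end AlgVariety

/-! ### Permutability by transport between classes -/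

namespace AlgCongruence

variable {L : FirstOrder.Language.{u, v}} {A : Type w} [L.Structure A]

/-- Every element of the `a`-class of `s` is `c`-related to an element of the `a`-class of `t`. -/
def Reaches (a c : AlgCongruence L A) (s t : A) : Prop :=
  ∀ r, a.r r s → ∃ r', a.r r' t ∧ c.r r r'

theorem Reaches.trans {a c : AlgCongruence L A} {s t q : A} (h : Reaches a c s t)
    (h' : Reaches a c t q) : Reaches a c s q := by
  intro r hr
  obtain ⟨r', h1, h2⟩ := h r hr
  obtain ⟨r'', h3, h4⟩ := h' r' h1
  exact ⟨r'', h3, Setoid.trans' _ h2 h4⟩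

theorem Preserving.rel₄ {φ : (Fin 4 → A) → A} (hφ : Preserving L A φ) (c : AlgCongruence L A)
    {x y z t x' y' z' t' : A} (hx : c.r x x') (hy : c.r y y') (hz : c.r z z') (ht : c.r t t') :
    c.r (φ ![x, y, z, t]) (φ ![x', y', z', t']) := by
  refine hφ c _ _ fun i => ?_
  fin_cases i
  exacts [hx, hy, hz, ht]

/-- The witness for r is φ(r,y,z,r), which is c-related to φ(r,y,y,r) = r. -/
theorem reaches_of_preserving {a c : AlgCongruence L A} {φ : (Fin 4 → A) → A}
    (hφ : Preserving L A φ) (hφ' : ∀ x y, φ ![x, y, y, x] = x) (s : A) {y z : A} (h : c.r y z) :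
    Reaches a c s (φ ![s, y, z, s]) := by
  intro r hr
  refine ⟨φ ![r, y, z, r], hφ.rel₄ a hr (Setoid.refl' _ _) (Setoid.refl' _ _) hr, ?_⟩
  have := hφ.rel₄ c (Setoid.refl' _ r) (Setoid.refl' _ y) h (Setoid.refl' _ r)
  rwa [hφ'] at this

section

variable [IsModularLattice (AlgCongruence L A)] {a b e c : AlgCongruence L A}

/-- A form of the term condition: changing `y` to the `c`-related `z` in an equation between values
of an operation. -/
theorem reaches_of_eq
    (hab : a ⊓ b = ⊥) (hae : a ≤ e) (hce : c ≤ e)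
    (hdec : ∀ x y, e.r x y → ∃ q, a.r q x ∧ b.r q y)
    {φ : (Fin 4 → A) → A} (hφ : Preserving L A φ) {y z : A} (h : c.r y z)
    {s₁ s₂ s₃ t₁ t₂ t₃ : A} (h₁ : e.r t₁ s₁) (h₂ : e.r t₂ s₂) (h₃ : e.r t₃ s₃)
    (heq : φ ![s₁, s₂, y, s₃] = φ ![t₁, t₂, y, t₃]) :
    Reaches a c (φ ![s₁, s₂, z, s₃]) (φ ![t₁, t₂, z, t₃]) := by
  obtain ⟨q₁, ha₁, hb₁⟩ := hdec _ _ h₁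
  obtain ⟨q₂, ha₂, hb₂⟩ := hdec _ _ h₂
  obtain ⟨q₃, ha₃, hb₃⟩ := hdec _ _ h₃
  -- Each qᵢ is a-related to tᵢ and b-related to sᵢ, so by `heq` both sides are related by a and by
  -- b, hence equal.
  have hy : φ ![q₁, q₂, y, q₃] = φ ![s₁, s₂, y, s₃] := by
    have h1 : a.r (φ ![q₁, q₂, y, q₃]) (φ ![s₁, s₂, y, s₃]) := by
      rw [heq]
      exact hφ.rel₄ a ha₁ ha₂ (Setoid.refl' _ _) ha₃
    have h2 : b.r (φ ![q₁, q₂, y, q₃]) (φ ![s₁, s₂, y, s₃]) :=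
      hφ.rel₄ b hb₁ hb₂ (Setoid.refl' _ _) hb₃
    -- The bottom congruence is defined as an infimum; comparing it with equality turns a ⊓ b = ⊥
    -- into an equality of elements.
    let eqC : AlgCongruence L A :=
      { toSetoid := ⊥
        map_fun := fun f x y h => congrArg (funMap f) (funext h) }
    have h3 : a ⊓ b ≤ eqC := hab.trans_le bot_le
    exact h3 (inf_of_r h1 h2)
  have hz : c.r (φ ![s₁, s₂, z, s₃]) (φ ![q₁, q₂, z, q₃]) := by
    refine Setoid.trans' _ (hφ.rel₄ c (Setoid.refl' _ _) (Setoid.refl' _ _) (Setoid.symm' _ h)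
      (Setoid.refl' _ _)) ?_
    rw [← hy]
    exact hφ.rel₄ c (Setoid.refl' _ _) (Setoid.refl' _ _) h (Setoid.refl' _ _)
  have hbz : b.r (φ ![s₁, s₂, z, s₃]) (φ ![q₁, q₂, z, q₃]) :=
    hφ.rel₄ b (Setoid.symm' _ hb₁) (Setoid.symm' _ hb₂) (Setoid.refl' _ _) (Setoid.symm' _ hb₃)
  have haz : a.r (φ ![q₁, q₂, z, q₃]) (φ ![t₁, t₂, z, t₃]) :=
    hφ.rel₄ a ha₁ ha₂ (Setoid.refl' _ _) ha₃
  intro r hr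
  -- The element r' completes a rectangle with a-sides and b-sides over the pair in `hz`, and
  -- shifting carries c to the pair r, r'.
  obtain ⟨r', har, hbr⟩ := hdec (φ ![t₁, t₂, z, t₃]) r (Setoid.trans' _ (hae (Setoid.symm' _ haz))
    (Setoid.trans' _ (hce (Setoid.symm' _ hz)) (hae (Setoid.symm' _ hr))))
  exact ⟨r', har, shifting (hab.trans_le bot_le) (Setoid.symm' _ hr)
    (Setoid.trans' _ haz (Setoid.symm' _ har)) hbz (Setoid.symm' _ hbr) hz⟩

/-- For s = φ(y,y,z,z), Day's identity gives φ(s,z,z,s) = s = φ(y,y,z,z). Changing the third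
argument from z to y on both sides, the class of s reaches that of φ(s,z,y,s), and by the term
condition that of φ(y,y,y,z). The converse starts from m = φ(y,y,y,z) = φ(m,y,y,m). -/
theorem reaches_of_day
    (hab : a ⊓ b = ⊥) (hae : a ≤ e) (hce : c ≤ e)
    (hdec : ∀ x y, e.r x y → ∃ q, a.r q x ∧ b.r q y)
    {φ : (Fin 4 → A) → A} (hφ : Preserving L A φ)
    (hφ' : ∀ x y, φ ![x, y, y, x] = x) {y z : A} (h : c.r y z) :
    Reaches a c (φ ![y, y, z, z]) (φ ![y, y, y, z]) ∧
      Reaches a c (φ ![y, y, y, z]) (φ ![y, y, z, z]) := by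
  have hzy : c.r z y := Setoid.symm' _ h
  have hs : c.r y (φ ![y, y, z, z]) := by
    have := hφ.rel₄ c (Setoid.refl' _ y) (Setoid.refl' _ y) h h
    rwa [hφ'] at this
  have hm : c.r y (φ ![y, y, y, z]) := by
    have := hφ.rel₄ c (Setoid.refl' _ y) (Setoid.refl' _ y) (Setoid.refl' _ y) h
    rwa [hφ'] at this
  constructor
  · refine (reaches_of_preserving hφ hφ' _ hzy).trans
      (reaches_of_eq hab hae hce hdec hφ hzy (hce hs) (hce h)
        (hce (Setoid.trans' _ hzy hs)) ?_)
    rw [hφ']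
  · refine (reaches_of_preserving hφ hφ' _ h).trans
      (reaches_of_eq hab hae hce hdec hφ h (hce hm) (Setoid.refl' _ _)
        (hce (Setoid.trans' _ hzy hm)) ?_)
    rw [hφ']

end

/-- In an algebra of a congruence modular variety, let `a`, `b` be congruences with trivial
intersection such that `e ⊆ a ∘ b`. Then `a` permutes with all congruences contained in `e`. -/
theorem exists_of_isCongruenceModular [L.IsAlgebraic] {V : AlgVariety L}
    (hV : AlgVariety.IsCongruenceModular.{u, v, w} V) {A : AlgVariety.Algebra.{u, v, w} V}
    {a b e c : AlgCongruence L A} (hab : a ⊓ b = ⊥) (hae : a ≤ e) (hce : c ≤ e)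
    (hdec : ∀ x y, e.r x y → ∃ q, a.r q x ∧ b.r q y) {x y z : A} (hxy : a.r x y) (hyz : c.r y z) :
    ∃ q, c.r x q ∧ a.r q z := by
  have _ := hV A
  have key : ∀ φ : (Fin 4 → A) → A, Relation.ReflTransGen (DayStep L A)
      (fun x => x 0) φ → Reaches a c y (φ ![y, y, z, z]) := by
    intro φ h
    induction h with
    | refl => exact fun r hr => ⟨r, hr, Setoid.refl' _ _⟩
    | @tail φ ψ _ hs ih =>
      obtain ⟨h1, h2, h3, h4, h5 | h5⟩ := hs
      · rwa [← h5]
      -- The two operations agree at (y,y,y,z), so the route from one value at (y,y,z,z) to the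
      -- other passes through there.
      · refine ih.trans ((reaches_of_day hab hae hce hdec h1 h3 hyz).1.trans ?_)
        rw [h5]
        exact (reaches_of_day hab hae hce hdec h2 h4 hyz).2
  obtain ⟨q, hq, hq'⟩ := key _ (AlgVariety.exists_day_chain hV A) x hxy
  exact ⟨q, hq', hq⟩

end AlgCongruence

/-! ### Points over `Y` in terms of elements -/

namespace AlgVariety

open FirstOrder.Language.Structure

variable {L : FirstOrder.Language.{u, v}} {V : AlgVariety L}
  {Y : Algebra.{u, v, w} V}

/-- The underlying algebra of a point over `Y`. -/
abbrev ptAlg (X : PtFibre Y) : Algebra.{u, v, w} V := X.right.left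

/-- The underlying homomorphism of a morphism of points. -/
def ptHom {X X' : PtFibre Y} (f : X ⟶ X') : L.Hom (ptAlg X) (ptAlg X') := f.right.left

/-- The homomorphism to `Y` of which `X` is a section. -/
def ptProj (X : PtFibre Y) : L.Hom (ptAlg X) Y := X.right.hom

/-- The chosen section of a point over `Y`. -/
def ptSec (X : PtFibre Y) : L.Hom Y (ptAlg X) := X.hom.left

theorem ptHom_comp {X X' X'' : PtFibre Y} (f : X ⟶ X') (g : X' ⟶ X'') (x : ptAlg X) :
    ptHom (f ≫ g) x = ptHom g (ptHom f x) := rfl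

theorem ptProj_ptHom {X X' : PtFibre Y} (f : X ⟶ X') (x : ptAlg X) :
    ptProj X' (ptHom f x) = ptProj X x :=
  congrArg (fun h : ptAlg X ⟶ Y => h x) (Over.w f.right)

theorem ptHom_ptSec {X X' : PtFibre Y} (f : X ⟶ X') (y : Y) :
    ptHom f (ptSec X y) = ptSec X' y :=
  congrArg (fun h : Over.mk (𝟙 Y) ⟶ X'.right => (h.left : L.Hom Y (ptAlg X')) y) (Under.w f)

theorem ptProj_ptSec (X : PtFibre Y) (y : Y) : ptProj X (ptSec X y) = y :=
  congrArg (fun h : Y ⟶ Y => h y) (Over.w X.hom)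

theorem ptHom_ext {X X' : PtFibre Y} {f g : X ⟶ X'} (h : ∀ x, ptHom f x = ptHom g x) : f = g :=
  Under.UnderMorphism.ext (Over.OverMorphism.ext (FirstOrder.Language.Hom.ext h))

theorem ptHom_congr {X X' : PtFibre Y} {f g : X ⟶ X'} (h : f = g) (x : ptAlg X) :
    ptHom f x = ptHom g x := h ▸ rfl

theorem ptHom_funMap {X X' : PtFibre Y} (f : X ⟶ X') {n : ℕ} (k : L.Functions n)
    (x : Fin n → ptAlg X) : ptHom f (funMap k x) = funMap k fun i => ptHom f (x i) :=
  (ptHom f).map_fun k x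

/-- The point with given underlying algebra, projection and section. -/
def ptMk (A : Algebra.{u, v, w} V) (p : L.Hom A Y) (s : L.Hom Y A) (h : ∀ y, p (s y) = y) :
    PtFibre Y :=
  Under.mk (Y := Over.mk (show A ⟶ Y from p))
    (Over.homMk (show Y ⟶ A from s) (FirstOrder.Language.Hom.ext h))

/-- The morphism of points with given underlying homomorphism. -/
def ptHomMk {X X' : PtFibre Y} (f : L.Hom (ptAlg X) (ptAlg X'))
    (hp : ∀ x, ptProj X' (f x) = ptProj X x) (hs : ∀ y, f (ptSec X y) = ptSec X' y) : X ⟶ X' :=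
  Under.homMk (Over.homMk (show X.right.left ⟶ X'.right.left from f)
    (FirstOrder.Language.Hom.ext hp))
    (Over.OverMorphism.ext (FirstOrder.Language.Hom.ext hs))

/-- A zero map factors through the zero object, whose underlying algebra is `Y`. -/
theorem ptHom_zero {X X' : PtFibre Y} (x : ptAlg X) :
    ptHom (0 : X ⟶ X') x = ptSec X' (ptProj X x) := by
  let O : PtFibre Y := Under.mk (𝟙 (Over.mk (𝟙 Y)))
  have h : (0 : X ⟶ X') = (0 : X ⟶ O) ≫ (0 : O ⟶ X') := by simp
  rw [h, ptHom_comp]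
  have h1 : ptHom (0 : X ⟶ O) x = ptProj X x := ptProj_ptHom (0 : X ⟶ O) x
  rw [h1]
  exact ptHom_ptSec (0 : O ⟶ X') (ptProj X x)

variable [L.IsAlgebraic]

section Agree

variable {A B C D : PtFibre Y} (f : A ⟶ C) (g : B ⟶ C) (f' : A ⟶ D) (g' : B ⟶ D)

/-- The algebra of pairs `(a, b)` with `f a = g b` and `f' a = g' b`. -/
def agreeAlg : Algebra.{u, v, w} V where
  carrier := {x : ptAlg A × ptAlg B // ptHom f x.1 = ptHom g x.2 ∧ ptHom f' x.1 = ptHom g' x.2}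
  str :=
    { funMap := fun k x => ⟨(funMap k fun i => (x i).1.1, funMap k fun i => (x i).1.2), by
        simp only [ptHom_funMap, (x _).2.1, (x _).2.2, and_self]⟩
      RelMap := fun r _ => isEmptyElim r }
  satisfies e he x := by
    let _ : L.Structure {x : ptAlg A × ptAlg B //
        ptHom f x.1 = ptHom g x.2 ∧ ptHom f' x.1 = ptHom g' x.2} :=
      { funMap := fun k x => ⟨(funMap k fun i => (x i).1.1, funMap k fun i => (x i).1.2), by
          simp only [ptHom_funMap, (x _).2.1, (x _).2.2, and_self]⟩
        RelMap := fun r _ => isEmptyElim r }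
    have key : ∀ t : L.Term ℕ, (t.realize x).1 =
        (t.realize fun n => (x n).1.1, t.realize fun n => (x n).1.2) := by
      intro t
      induction t with
      | var n => rfl
      | func k ts ih =>
        change (funMap k (fun i => ((ts i).realize x).1.1),
          funMap k (fun i => ((ts i).realize x).1.2)) = _
        simp only [ih, FirstOrder.Language.Term.realize_func]
    apply Subtype.ext
    rw [key, key, (ptAlg A).satisfies e he, (ptAlg B).satisfies e he]

/-- The point of pairs `(a, b)` with `f a = g b` and `f' a = g' b`. -/
def agreePt : PtFibre Y :=
  ptMk (agreeAlg f g f' g')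
    { toFun := fun x => ptProj A x.1.1
      map_fun' := fun k _ => (ptProj A).map_fun k _
      map_rel' := fun r => isEmptyElim r }
    { toFun := fun y => ⟨(ptSec A y, ptSec B y), by simp only [ptHom_ptSec, and_self]⟩
      map_fun' := fun k x => Subtype.ext
        (Prod.ext ((ptSec A).map_fun k x) ((ptSec B).map_fun k x))
      map_rel' := fun r => isEmptyElim r }
    (fun y => ptProj_ptSec A y)

/-- The first projection of `agreePt`. -/
def agreeFst : agreePt f g f' g' ⟶ A :=
  ptHomMk
    { toFun := fun x : agreeAlg f g f' g' => x.1.1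
      map_fun' := fun _ _ => rfl
      map_rel' := fun r => isEmptyElim r }
    (fun _ => rfl) (fun _ => rfl)

/-- The second projection of `agreePt`. -/
def agreeSnd : agreePt f g f' g' ⟶ B :=
  ptHomMk
    { toFun := fun x : agreeAlg f g f' g' => x.1.2
      map_fun' := fun _ _ => rfl
      map_rel' := fun r => isEmptyElim r }
    (fun x => by
      have h := congrArg (ptProj C) x.2.1
      rw [ptProj_ptHom, ptProj_ptHom] at h
      exact h.symm) (fun _ => rfl)

theorem agree_condition : agreeFst f g f' g' ≫ f = agreeSnd f g f' g' ≫ g :=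
  ptHom_ext fun x => x.2.1

theorem agree_condition' : agreeFst f g f' g' ≫ f' = agreeSnd f g f' g' ≫ g' :=
  ptHom_ext fun x => x.2.2

end Agree

/-! ### Monomorphisms, products, pullbacks and surjections on elements -/

section Elements

variable {A B C : PtFibre Y}

/-- The concrete kernel pair `agreePt m m m m` has a and b as the coordinates of one element, and a
monomorphism identifies its two projections. -/
theorem ptHom_injective (m : A ⟶ B) [Mono m] {a b : ptAlg A} (h : ptHom m a = ptHom m b) :
    a = b :=
  ptHom_congr ((cancel_mono m).1 (agree_condition m m m m))
    (⟨(a, b), h, h⟩ : agreeAlg m m m m)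

theorem eq_of_isRelationSpan {f : A ⟶ B} {g : A ⟶ C} (hfg : IsRelationSpan f g) {a b : ptAlg A}
    (h : ptHom f a = ptHom f b) (h' : ptHom g a = ptHom g b) : a = b := by
  have _ : Mono (prod.lift f g) := hfg
  have hfst : agreeFst f f g g = agreeSnd f f g g := by
    rw [← cancel_mono (prod.lift f g)]
    refine Limits.prod.hom_ext ?_ ?_
    · simp only [Category.assoc, prod.lift_fst]
      exact agree_condition f f g g
    · simp only [Category.assoc, prod.lift_snd]
      exact agree_condition' f f g g
  exact ptHom_congr hfst (⟨(a, b), h, h'⟩ : agreeAlg f f g g)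

theorem prod_ext {a b : ptAlg (A ⨯ B)} (h : ptHom prod.fst a = ptHom prod.fst b)
    (h' : ptHom prod.snd a = ptHom prod.snd b) : a = b :=
  eq_of_isRelationSpan (by unfold IsRelationSpan; rw [prod.lift_fst_snd]; infer_instance) h h'

theorem exists_prod (a : ptAlg A) (b : ptAlg B) (h : ptProj A a = ptProj B b) :
    ∃ t : ptAlg (A ⨯ B), ptHom prod.fst t = a ∧ ptHom prod.snd t = b := by
  -- The product in the fibre is the fibred product over `Y`; lying over the same element of `Y` is
  -- encoded as agreement of zero maps.
  have h0 : ptHom (0 : A ⟶ A) a = ptHom (0 : B ⟶ A) b := by rw [ptHom_zero, ptHom_zero, h]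
  let E := agreePt (0 : A ⟶ A) (0 : B ⟶ A) (0 : A ⟶ A) (0 : B ⟶ A)
  let x : ptAlg E := (⟨(a, b), h0, h0⟩ : agreeAlg _ _ _ _)
  exact ⟨ptHom (prod.lift (agreeFst _ _ _ _) (agreeSnd _ _ _ _)) x,
    ptHom_congr (prod.lift_fst _ _) x, ptHom_congr (prod.lift_snd _ _) x⟩

theorem pullback_ext {f : A ⟶ C} {g : B ⟶ C} {a b : ptAlg (pullback f g)}
    (h : ptHom (pullback.fst f g) a = ptHom (pullback.fst f g) b)
    (h' : ptHom (pullback.snd f g) a = ptHom (pullback.snd f g) b) : a = b :=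
  ptHom_congr (pullback.hom_ext (agree_condition (pullback.fst f g) _ (pullback.snd f g) _)
    (agree_condition' _ _ _ _)) (⟨(a, b), h, h'⟩ : agreeAlg _ _ _ _)

theorem exists_pullback (f : A ⟶ C) (g : B ⟶ C) (a : ptAlg A) (b : ptAlg B)
    (h : ptHom f a = ptHom g b) :
    ∃ t : ptAlg (pullback f g),
      ptHom (pullback.fst f g) t = a ∧ ptHom (pullback.snd f g) t = b := by
  let x : ptAlg (agreePt f g f g) := (⟨(a, b), h, h⟩ : agreeAlg _ _ _ _)
  exact ⟨ptHom (pullback.lift (agreeFst f g f g) (agreeSnd f g f g) (agree_condition f g f g)) x,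
    ptHom_congr (pullback.lift_fst _ _ _) x, ptHom_congr (pullback.lift_snd _ _ _) x⟩

theorem isIso_of_bijective (f : A ⟶ B) (hf : Function.Bijective (ptHom f)) : IsIso f := by
  let e := Equiv.ofBijective _ hf
  have he : ∀ b, ptHom f (e.symm b) = b := e.apply_symm_apply
  let g : B ⟶ A := ptHomMk
    { toFun := e.symm
      map_fun' := fun k x => hf.1 (by
        rw [ptHom_funMap]
        simp only [Function.comp_def, he])
      map_rel' := fun r => isEmptyElim r }
    (fun x => by
      rw [← ptProj_ptHom f]
      exact congrArg _ (he x))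
    (fun y => hf.1 ((he _).trans (ptHom_ptSec f y).symm))
  exact ⟨g, ptHom_ext fun x => hf.1 (he _), ptHom_ext he⟩

/-- A monomorphism through which a surjection factors is bijective, hence invertible. -/
theorem extremalEpi_of_surjective (f : A ⟶ B) (hf : Function.Surjective (ptHom f)) :
    ExtremalEpi f where
  left_cancellation g h hgh := ptHom_ext fun b => by
    obtain ⟨a, rfl⟩ := hf b
    exact ptHom_congr hgh a
  isIso p i fac _ := isIso_of_bijective i ⟨fun _ _ => ptHom_injective i, fun b => by
    obtain ⟨a, rfl⟩ := hf b
    exact ⟨ptHom p a, ptHom_congr fac a⟩⟩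

end Elements

/-! ### Internal equivalence relations as congruences, and the map ζ -/

section Relations

variable {W X Z : PtFibre Y}

theorem ptRel_ker (f : W ⟶ X) (a b : ptAlg W) :
    ptRel (InternalEquiv.ker f) a b ↔ ptHom f a = ptHom f b := by
  constructor
  · rintro ⟨t, rfl, rfl⟩
    exact ptHom_congr (pullback.condition (f := f) (g := f)) t
  · exact exists_pullback f f a b

/-- The congruence on the underlying algebra given by an internal equivalence relation. -/
def ptCongruence (T : InternalEquiv W) : AlgCongruence L (ptAlg W) where
  r := ptRel T
  iseqv :=
    { refl := fun x => by
        obtain ⟨s, h, h'⟩ := T.refl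
        exact ⟨ptHom s x, ptHom_congr h x, ptHom_congr h' x⟩
      symm := by
        rintro _ _ ⟨t, rfl, rfl⟩
        obtain ⟨s, h, h'⟩ := T.symm
        exact ⟨ptHom s t, ptHom_congr h t, ptHom_congr h' t⟩
      trans := by
        rintro _ _ _ ⟨t, rfl, rfl⟩ ⟨t', h, rfl⟩
        obtain ⟨τ, h1, h2⟩ := T.trans
        obtain ⟨q, rfl, rfl⟩ := exists_pullback T.d₁ T.d₀ t t' h.symm
        exact ⟨ptHom τ q, ptHom_congr h1 q, ptHom_congr h2 q⟩ }
  map_fun k x y h := by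
    choose t h0 h1 using h
    refine ⟨funMap k t, (ptHom_funMap T.d₀ k t).trans ?_, (ptHom_funMap T.d₁ k t).trans ?_⟩
    · exact congrArg _ (funext h0)
    · exact congrArg _ (funext h1)

/-- The kernel of the projection of a point. -/
def projCongruence (W : PtFibre Y) : AlgCongruence L (ptAlg W) where
  toSetoid := Setoid.ker (ptProj W)
  map_fun k x y h := by
    change ptProj W _ = ptProj W _
    rw [(ptProj W).map_fun, (ptProj W).map_fun]
    exact congrArg _ (funext h)

theorem ptCongruence_le_proj (T : InternalEquiv W) : ptCongruence T ≤ projCongruence W := by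
  rintro _ _ ⟨t, rfl, rfl⟩
  exact (ptProj_ptHom T.d₀ t).trans (ptProj_ptHom T.d₁ t).symm

/-- The elements of `R □ S`. -/
theorem exists_square (R S : InternalEquiv W) (r r' : ptAlg R.obj) (s s' : ptAlg S.obj)
    (h₁ : ptHom R.d₀ r = ptHom S.d₀ s) (h₂ : ptHom R.d₁ r = ptHom S.d₀ s')
    (h₃ : ptHom R.d₀ r' = ptHom S.d₁ s) (h₄ : ptHom R.d₁ r' = ptHom S.d₁ s') :
    ∃ q, ptHom (InternalEquiv.squareFst R S) q = r ∧
      ptHom (InternalEquiv.squareSnd R S) q = s' := by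
  have hr : ptProj _ r = ptProj _ r' := by
    rw [← ptProj_ptHom R.d₀ r, ← ptProj_ptHom R.d₀ r', h₁, h₃, ptProj_ptHom, ptProj_ptHom]
  have hs : ptProj _ s = ptProj _ s' := by
    rw [← ptProj_ptHom S.d₀ s, ← ptProj_ptHom S.d₀ s', ← h₁, ← h₂, ptProj_ptHom, ptProj_ptHom]
  obtain ⟨a, ha, ha'⟩ := exists_prod r r' hr
  obtain ⟨b, hb, hb'⟩ := exists_prod s s' hs
  obtain ⟨q, hq, hq'⟩ := exists_pullback
    (prod.map (prod.lift R.d₀ R.d₁) (prod.lift R.d₀ R.d₁))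
    (prod.lift (prod.map S.d₀ S.d₀) (prod.map S.d₁ S.d₁)) a b (by
      refine prod_ext (prod_ext ?_ ?_) (prod_ext ?_ ?_) <;>
        simp only [← ptHom_comp, Category.assoc, prod.map_fst, prod.map_snd, prod.lift_fst,
          prod.lift_snd] <;>
        simp only [ptHom_comp, ha, ha', hb, hb', h₁, h₂, h₃, h₄])
  refine ⟨q, ?_, ?_⟩
  · rw [InternalEquiv.squareFst, ptHom_comp, hq, ha]
  · rw [InternalEquiv.squareSnd, ptHom_comp, hq', hb']

theorem exists_of_square (R S : InternalEquiv W) (q : ptAlg (InternalEquiv.square R S)) :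
    ∃ c, ptRel S (ptHom R.d₀ (ptHom (InternalEquiv.squareFst R S) q)) c ∧
      ptRel R c (ptHom S.d₁ (ptHom (InternalEquiv.squareSnd R S) q)) := by
  have h := pullback.condition
    (f := prod.map (prod.lift R.d₀ R.d₁) (prod.lift R.d₀ R.d₁))
    (g := prod.lift (prod.map S.d₀ S.d₀) (prod.map S.d₁ S.d₁))
  have h₁ := ptHom_congr (congrArg (fun k => k ≫ prod.fst ≫ prod.fst) h) q
  have h₂ := ptHom_congr (congrArg (fun k => k ≫ prod.snd ≫ prod.fst) h) q
  have h₃ := ptHom_congr (congrArg (fun k => k ≫ prod.snd ≫ prod.snd) h) q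
  simp only [Category.assoc, prod.map_fst, prod.map_snd, prod.lift_fst, prod.lift_snd,
    prod.map_fst_assoc, prod.map_snd_assoc, prod.lift_fst_assoc, prod.lift_snd_assoc] at h₁ h₂ h₃
  exact ⟨_, ⟨ptHom (pullback.snd _ _ ≫ prod.fst) q, h₁.symm, rfl⟩,
    ⟨ptHom (pullback.fst _ _ ≫ prod.snd) q, h₂, h₃⟩⟩

/-- An element of R ×₁ S is a path x R y S z, and lifting it to R □ S means finding the fourth
vertex. This serves both to exploit difunctionality and to obtain Axiom ∗. -/
theorem zeta_surjective_iff (R S : InternalEquiv W) :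
    Function.Surjective (ptHom (InternalEquiv.zeta R S)) ↔
      ∀ x y z, ptRel R x y → ptRel S y z → ∃ c, ptRel S x c ∧ ptRel R c z := by
  constructor
  · rintro h _ _ _ ⟨r, rfl, rfl⟩ ⟨s, hs, rfl⟩
    obtain ⟨t, rfl, rfl⟩ := exists_pullback R.d₁ S.d₀ r s hs.symm
    obtain ⟨q, rfl⟩ := h t
    have h₁ := ptHom_congr (pullback.lift_fst _ _ (InternalEquiv.square_condition R S)) q
    have h₂ := ptHom_congr (pullback.lift_snd _ _ (InternalEquiv.square_condition R S)) q
    have := exists_of_square R S q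
    rwa [← h₁, ← h₂] at this
  · intro h t
    have ht := ptHom_congr (pullback.condition (f := R.d₁) (g := S.d₀)) t
    obtain ⟨c, ⟨s, hs, hs'⟩, ⟨r', hr, hr'⟩⟩ := h _ _ _ ⟨ptHom (pullback.fst _ _) t, rfl, rfl⟩
      ⟨ptHom (pullback.snd _ _) t, ht.symm, rfl⟩
    obtain ⟨q, hq, hq'⟩ := exists_square R S _ r' s _ hs.symm ht (hr.trans hs'.symm) hr'
    exact ⟨q, pullback_ext
      ((ptHom_congr (pullback.lift_fst _ _ (InternalEquiv.square_condition R S)) q).trans hq)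
      ((ptHom_congr (pullback.lift_snd _ _ (InternalEquiv.square_condition R S)) q).trans hq')⟩

/-- In a congruence modular variety, `R[f]` and `T` permute for every right punctual difunctional
relation `(f, g)` of points. -/
theorem exists_of_isRightPunctual (hV : IsCongruenceModular.{u, v, w} V) {f : W ⟶ X} {g : W ⟶ Z}
    (hfg : IsRelationSpan f g) (hp : IsRightPunctual f g) (hd : IsDifunctional f g)
    (T : InternalEquiv W) {x y z : ptAlg W} (hxy : ptRel (InternalEquiv.ker f) x y)
    (hyz : ptRel T y z) : ∃ c, ptRel T x c ∧ ptRel (InternalEquiv.ker f) c z := by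
  refine AlgCongruence.exists_of_isCongruenceModular hV (a := ptCongruence (InternalEquiv.ker f))
    (b := ptCongruence (InternalEquiv.ker g)) (e := projCongruence W) (c := ptCongruence T)
    (le_bot_iff.1 fun a b h => ?_) (ptCongruence_le_proj _) (ptCongruence_le_proj _) ?_ hxy hyz
  · have h1 := (ptRel_ker f a b).1
      ((inf_le_left : _ ⊓ ptCongruence (InternalEquiv.ker g) ≤ _) h)
    have h2 := (ptRel_ker g a b).1
      ((inf_le_right : ptCongruence (InternalEquiv.ker f) ⊓ _ ≤ _) h)
    rw [eq_of_isRelationSpan hfg h1 h2]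
  · intro a b hab
    obtain ⟨t, htg, htf⟩ := hp
    have hg (c : ptAlg W) : ptHom g (ptHom t (ptHom g c)) = ptHom g c := ptHom_congr htg _
    have hf (c : ptAlg W) : ptHom f (ptHom t (ptHom g c)) = ptSec X (ptProj W c) := by
      rw [← ptHom_comp, htf, ptHom_zero, ptProj_ptHom]
    have _ := hd.isIso
    have hs : Function.Surjective
        (ptHom (InternalEquiv.zeta (InternalEquiv.ker f) (InternalEquiv.ker g))) := fun q =>
      ⟨ptHom (inv (InternalEquiv.zeta _ _)) q, ptHom_congr (IsIso.inv_hom_id _) q⟩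
    -- The path is t(g b) R[f] t(g a) R[g] a: by `hf` the first two points have as common image
    -- under f the section's value over the shared element of `Y`.
    obtain ⟨c, hc, hc'⟩ := (zeta_surjective_iff _ _).1 hs (ptHom t (ptHom g b))
      (ptHom t (ptHom g a)) a
      ((ptRel_ker _ _ _).2 (by rw [hf, hf]; exact congrArg _ (Eq.symm hab)))
      ((ptRel_ker _ _ _).2 (hg a))
    refine ⟨c, hc', (ptRel_ker _ _ _).2 ?_⟩
    rw [← (ptRel_ker _ _ _).1 hc, hg]

end Relations

end AlgVariety

end

theorem mainTheorem5 {L : FirstOrder.Language.{u, v}} [L.IsAlgebraic] (V : AlgVariety L)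
    (hV : AlgVariety.IsCongruenceModular.{u, v, max u w} V)
    (Y : AlgVariety.Algebra.{u, v, max u w} V) :
    AxiomStar (PtFibre Y) ∧
      ∀ (W X Z : PtFibre Y) (f : W ⟶ X) (g : W ⟶ Z), IsRelationSpan f g → IsRightPunctual f g →
        IsDifunctional f g → ∀ T : InternalEquiv W,
          Relation.Comp (AlgVariety.ptRel (InternalEquiv.ker f)) (AlgVariety.ptRel T) =
            Relation.Comp (AlgVariety.ptRel T) (AlgVariety.ptRel (InternalEquiv.ker f)) := by
  have key : ∀ (W X Z : PtFibre Y) (f : W ⟶ X) (g : W ⟶ Z), IsRelationSpan f g →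
      IsRightPunctual f g → IsDifunctional f g → ∀ (T : InternalEquiv W) x y z,
        AlgVariety.ptRel (InternalEquiv.ker f) x y → AlgVariety.ptRel T y z →
          ∃ c, AlgVariety.ptRel T x c ∧ AlgVariety.ptRel (InternalEquiv.ker f) c z :=
    fun _ _ _ _ _ hfg hp hd T _ _ _ h h' =>
      AlgVariety.exists_of_isRightPunctual hV hfg hp hd T h h'
  refine ⟨fun W X Z f g hfg hp hd T => AlgVariety.extremalEpi_of_surjective _
    ((AlgVariety.zeta_surjective_iff _ _).2 (key W X Z f g hfg hp hd T)),
    fun W X Z f g hfg hp hd T => ?_⟩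
  funext x z
  refine propext ⟨fun ⟨y, h, h'⟩ => key W X Z f g hfg hp hd T x y z h h', fun ⟨y, h, h'⟩ => ?_⟩
  -- The other inclusion is the same statement for the reversed path.
  obtain ⟨c, hc, hc'⟩ := key W X Z f g hfg hp hd T z y x
    (Setoid.symm' (AlgVariety.ptCongruence (InternalEquiv.ker f)).toSetoid h')
    (Setoid.symm' (AlgVariety.ptCongruence T).toSetoid h)
  exact ⟨c, Setoid.symm' (AlgVariety.ptCongruence (InternalEquiv.ker f)).toSetoid hc',
    Setoid.symm' (AlgVariety.ptCongruence T).toSetoid hc⟩
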